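/- Let $L\ge 1$ and $r,\alpha,\beta>0$. Consider the totally asymmetric simple exclusion process with a blockage: the continuous-time Markov process on configurations $\eta\in\{0,1\}^{\{-L+1,\dots,L\}}$ in which a particle enters at site $-L+1$ (if vacant) at rate $\alpha$, a particle at site $L$ is removed at rate $\beta$, and each particle jumps to the neighbouring site on its right, if that site is vacant, at rate $r$ for the jump from site $0$ to site $1$ and at rate $1$ for all other jumps. This process has a unique stationary state; for $\alpha=\beta=a$ let $$J_L(r,a)=r\,\Pr(\eta(0)=1,\ \eta(1)=0)$$ denote the stationary current, and write $J_L(r)=J_L(r,1)$. Theorem 2. Fix $L_2$. Then for all $1\le L_1\le L_2$ and all $a>0$, as $r\downarrow 0$, $$J_{L_2}(r,a)=J_{L_1}(r)+O(r^{L_1+1}),$$ where the implied constant may depend on $L_1$, $L_2$ and $a$. -/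

import Mathlib

open Filter Topology Asymptotics

namespace BlockedTASEP

/-- The `2L` sites `-L+1, ..., L`; the blockage is the bond between the sites `0` and `1`. -/
abbrev Site (L : ℕ) : Type := Finset.Icc (1 - (L : ℤ)) (L : ℤ)

/-- A configuration of occupation numbers: `true` is an occupied site, `false` a vacant one. -/
abbrev Config (L : ℕ) : Type := Site L → Bool

/-- The configuration after an attempted jump from site `i` to site `j`. -/
def jump {L : ℕ} (i j : Site L) (η : Config L) : Config L := fun k =>
  if k = j ∧ η i = true then true
  else if k = i ∧ η j = false then false
  else η k

/-- The jump rate across the bond from site `i` to site `i + 1`. -/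
def bondRate (r : ℝ) (i : ℤ) : ℝ := if i = 0 then r else 1

/-- The generator of the process: particles enter at the leftmost site `-L+1` with rate `α`, leave
at the rightmost site `L` with rate `β`, and jump to the neighbouring site on the right, if that
site is vacant, with rate `r` across the blockage and with rate `1` across all other bonds. -/
noncomputable def generator (L : ℕ) (α β r : ℝ) (f : Config L → ℝ) (η : Config L) : ℝ :=
  (∑ i : Site L, if (i : ℤ) = 1 - (L : ℤ) then
      α * (f (Function.update η i true) - f η) else 0)
  + (∑ i : Site L, ∑ j : Site L, if (j : ℤ) = (i : ℤ) + 1 then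
      bondRate r i * (f (jump i j η) - f η) else 0)
  + (∑ i : Site L, if (i : ℤ) = (L : ℤ) then
      β * (f (Function.update η i false) - f η) else 0)

/-- `p` is a stationary state: a probability vector on the configurations for which the expectation
of the generator applied to any function vanishes. -/
def IsStationary (L : ℕ) (α β r : ℝ) (p : Config L → ℝ) : Prop :=
  p ∈ stdSimplex ℝ (Config L) ∧
    ∀ f : Config L → ℝ, ∑ η : Config L, p η * generator L α β r f η = 0

/-- The current across the blockage in the state `p`: `r` times the probability that site `0` is
occupied and site `1` is vacant. -/
noncomputable def blockageCurrent (L : ℕ) (r : ℝ) (p : Config L → ℝ) : ℝ :=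
  ∑ i : Site L, ∑ j : Site L, if (i : ℤ) = 0 ∧ (j : ℤ) = 1 then
    r * ∑ η : Config L with η i = true ∧ η j = false, p η else 0

open Classical in
/-- `J L r a` is the current in the stationary state of the system with `2L` sites, blockage
transmission rate `r` and boundary rates `α = β = a`. -/
noncomputable def J (L : ℕ) (r a : ℝ) : ℝ :=
  if h : ∃ p : Config L → ℝ, IsStationary L a a r p then blockageCurrent L r h.choose else 0

end BlockedTASEP

/-! For small `r` the state is close to the step configuration, and only jumps across the blockage
create holes on the left or particles on the right. Extending configurations to `ℤ` by the step
turns entrances and exits into ordinary hops.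

Without the blockage jump, the other hops drive a finite window to the step, so the Poisson equation
with right-hand side `f` has a solution `g` whenever `f` vanishes at the step. Testing stationarity
on `g` then yields a factor `r`. On the whole system this shows that `k` left holes, or `k` right
particles, have probability `O(r ^ k)` (`expect_isBigO_pow`).

In a window strictly inside both systems all rates off the blockage are `1`, so the same `g` serves
both. Besides the factor `r` there remain two defects: an entrance is missing when site `-m` is
vacant, and an exit is missing when site `n + 1` is occupied (`IsStationary.expect_clip_eq`). A
defect enlarges the window by one site, but its support then has one more hole or particle.

In `expect_sub_expect_isBigO` the invariant `k + m ≤ L₁ + max 1 (leftHoles ζ)` and its mirror image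
survive both operations. When the window reaches a boundary of the smaller system, each expectation
is separately `O(r ^ k)`. The `max 1` is there because being off the step already costs one factor
`r`, and because the first missing entrance needs two adjacent holes. Starting from `m = n = 1`
allows `k = L₁`; the factor `r` in the current supplies one more order. -/

namespace BlockedTASEP

/-! ### Finite chains: stationary vectors and the Poisson equation -/

section FiniteChain

variable {X ι : Type*}

/-- The generator of the chain that applies the map `T i` at rate `c i`, for `i ∈ s`. -/
def mapGenerator (s : Finset ι) (T : ι → X → X) (c : ι → ℝ) (f : X → ℝ) (x : X) : ℝ :=
  ∑ i ∈ s, c i * (f (T i x) - f x)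

/-- A signed stationary vector of a chain with a globally reachable state has constant sign. -/
theorem nonneg_or_nonpos_of_stationary [Fintype X] (s : Finset ι) (T : ι → X → X) (c : ι → ℝ)
    (hc : ∀ i ∈ s, 0 < c i) (z : X)
    (hz : ∀ A : Set X, A.Nonempty → (∀ i ∈ s, ∀ x ∈ A, T i x ∈ A) → z ∈ A)
    (p : X → ℝ) (hp : ∀ f : X → ℝ, ∑ x, p x * mapGenerator s T c f x = 0) :
    (∀ x, 0 ≤ p x) ∨ (∀ x, p x ≤ 0) := by
  -- Test stationarity on the sign of `p`: every term of the sum is nonpositive, so every term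
  -- vanishes and the maps preserve strict signs.
  have key : ∀ x, ∀ i ∈ s, p x * Real.sign (p (T i x)) = p x * Real.sign (p x) := by
    have hle : ∀ x, ∀ i, p x * Real.sign (p (T i x)) ≤ p x * Real.sign (p x) := by
      intro x i
      rcases lt_trichotomy (p x) 0 with h | h | h
      · rw [Real.sign_of_neg h]
        rcases Real.sign_apply_eq (p (T i x)) with e | e | e <;> rw [e] <;> linarith
      · simp [h]
      · rw [Real.sign_of_pos h]
        rcases Real.sign_apply_eq (p (T i x)) with e | e | e <;> rw [e] <;> linarith
    have h0 := hp (fun x => Real.sign (p x))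
    have hterm : ∀ x, ∀ i ∈ s,
        c i * (p x * Real.sign (p (T i x)) - p x * Real.sign (p x)) ≤ 0 := fun x i hi =>
      mul_nonpos_of_nonneg_of_nonpos (hc i hi).le (by linarith [hle x i])
    have h1 : ∑ x, ∑ i ∈ s,
        c i * (p x * Real.sign (p (T i x)) - p x * Real.sign (p x)) = 0 := by
      rw [← h0]
      refine Finset.sum_congr rfl fun x _ => ?_
      rw [mapGenerator, Finset.mul_sum]
      exact Finset.sum_congr rfl fun i _ => by ring
    rw [Finset.sum_eq_zero_iff_of_nonpos
      (fun x _ => Finset.sum_nonpos fun i hi => hterm x i hi)] at h1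
    intro x i hi
    have h2 := h1 x (Finset.mem_univ x)
    rw [Finset.sum_eq_zero_iff_of_nonpos (fun i hi => hterm x i hi)] at h2
    have h3 := (mul_eq_zero.1 (h2 i hi)).resolve_left (hc i hi).ne'
    linarith
  by_contra! hcon
  obtain ⟨⟨x, hx⟩, ⟨y, hy⟩⟩ := hcon
  have hpos : z ∈ {x | 0 < p x} := by
    refine hz _ ⟨y, hy⟩ fun i hi x hx => ?_
    have h := key x i hi
    have hx' : 0 < p x := hx
    rw [Real.sign_of_pos hx'] at h
    have h' := mul_left_cancel₀ hx'.ne' h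
    by_contra hn
    rcases (not_lt.1 (show ¬0 < p (T i x) from hn)).lt_or_eq with e | e
    · rw [Real.sign_of_neg e] at h'; norm_num at h'
    · rw [e, Real.sign_zero] at h'; norm_num at h'
  have hneg : z ∈ {x | p x < 0} := by
    refine hz _ ⟨x, hx⟩ fun i hi x hx => ?_
    have h := key x i hi
    have hx' : p x < 0 := hx
    rw [Real.sign_of_neg hx'] at h
    have h' := mul_left_cancel₀ hx'.ne h
    by_contra hn
    rcases (not_lt.1 (show ¬p (T i x) < 0 from hn)).lt_or_eq with e | e
    · rw [Real.sign_of_pos e] at h'; norm_num at h'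
    · rw [← e, Real.sign_zero] at h'; norm_num at h'
  exact lt_asymm (show 0 < p z from hpos) hneg

/-- A finite chain with a globally reachable state has a unique stationary probability vector. -/
theorem existsUnique_stationary [Fintype X] (s : Finset ι) (T : ι → X → X)
    (c : ι → ℝ) (hc : ∀ i ∈ s, 0 < c i) (z : X)
    (hz : ∀ A : Set X, A.Nonempty → (∀ i ∈ s, ∀ x ∈ A, T i x ∈ A) → z ∈ A) :
    ∃! p : X → ℝ, p ∈ stdSimplex ℝ X ∧ ∀ f : X → ℝ, ∑ x, p x * mapGenerator s T c f x = 0 := by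
  classical
  let Q : Matrix X X ℝ := fun x y =>
    ∑ i ∈ s, c i * ((if T i x = y then 1 else 0) - if x = y then 1 else 0)
  have hQ : ∀ f : X → ℝ, Q.mulVec f = mapGenerator s T c f := by
    intro f
    ext x
    simp only [Matrix.mulVec, dotProduct, Q, mapGenerator, Finset.sum_mul]
    rw [Finset.sum_comm]
    refine Finset.sum_congr rfl fun i _ => ?_
    simp only [mul_assoc, sub_mul, ite_mul, one_mul, zero_mul, ← Finset.mul_sum,
      Finset.sum_sub_distrib, Finset.sum_ite_eq, Finset.mem_univ, if_true]
  -- The rows of `Q` sum to zero, so `Q` also has a left null vector.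
  have hdet : Q.det = 0 := by
    rw [← Matrix.exists_mulVec_eq_zero_iff]
    refine ⟨fun _ => 1, fun h => one_ne_zero (congrFun h z), ?_⟩
    rw [hQ]
    ext x
    simp [mapGenerator]
  obtain ⟨v, hv0, hv⟩ := Matrix.exists_vecMul_eq_zero_iff.2 hdet
  have hstat : ∀ f : X → ℝ, ∑ x, v x * mapGenerator s T c f x = 0 := by
    intro f
    have h : v ⬝ᵥ Q.mulVec f = 0 := by rw [Matrix.dotProduct_mulVec, hv, zero_dotProduct]
    rwa [hQ] at h
  have hsum0 : ∀ q : X → ℝ, (∀ f : X → ℝ, ∑ x, q x * mapGenerator s T c f x = 0) →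
      ∑ x, q x = 0 → q = 0 := by
    intro q hq hs
    ext x
    rcases nonneg_or_nonpos_of_stationary s T c hc z hz q hq with h | h
    · exact (Finset.sum_eq_zero_iff_of_nonneg (fun x _ => h x)).1 hs x (Finset.mem_univ x)
    · exact (Finset.sum_eq_zero_iff_of_nonpos (fun x _ => h x)).1 hs x (Finset.mem_univ x)
  have hS : ∑ x, v x ≠ 0 := fun h => hv0 (hsum0 v hstat h)
  refine ⟨fun x => v x / ∑ y, v y, ⟨⟨fun x => ?_, ?_⟩, fun f => ?_⟩, fun p hp => ?_⟩
  · rcases nonneg_or_nonpos_of_stationary s T c hc z hz v hstat with h | h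
    · exact div_nonneg (h x) (Finset.sum_nonneg fun y _ => h y)
    · exact div_nonneg_of_nonpos (h x) (Finset.sum_nonpos fun y _ => h y)
  · rw [← Finset.sum_div, div_self hS]
  · simp only [div_mul_eq_mul_div, ← Finset.sum_div, hstat, zero_div]
  · have h := hsum0 (fun x => p x - v x / ∑ y, v y) (fun f => ?_) ?_
    · ext x
      exact sub_eq_zero.1 (congrFun h x)
    · simp only [sub_mul, Finset.sum_sub_distrib, div_mul_eq_mul_div, ← Finset.sum_div, hstat,
        hp.2 f, zero_div, sub_zero]
    · rw [Finset.sum_sub_distrib, ← Finset.sum_div, div_self hS, hp.1.2, sub_self]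

/-- The solution of the Poisson equation for maps that decrease the potential `V`. -/
noncomputable def poissonSolution (s : Finset ι) (T : ι → X → X) (c : ι → ℝ) (V : X → ℕ)
    (f : X → ℝ) (x : X) : ℝ :=
  ((∑ i ∈ s, if _h : V (T i x) < V x then c i * poissonSolution s T c V f (T i x) else 0) - f x) /
    ∑ i ∈ s, if V (T i x) < V x then c i else 0
termination_by V x
decreasing_by assumption

theorem mapGenerator_poissonSolution (s : Finset ι) (T : ι → X → X) (c : ι → ℝ)
    (hc : ∀ i ∈ s, 0 < c i) (V : X → ℕ) (f : X → ℝ) (x : X)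
    (hV : ∀ i ∈ s, T i x ≠ x → V (T i x) < V x) (hf : (∀ i ∈ s, T i x = x) → f x = 0) :
    mapGenerator s T c (poissonSolution s T c V f) x = f x := by
  set g := poissonSolution s T c V f with hg
  have hgx : g x = ((∑ i ∈ s, if V (T i x) < V x then c i * g (T i x) else 0) - f x) /
      ∑ i ∈ s, if V (T i x) < V x then c i else 0 := by
    rw [hg, poissonSolution]
    simp only [dite_eq_ite]
  have hG : mapGenerator s T c g x =
      (∑ i ∈ s, if V (T i x) < V x then c i * g (T i x) else 0) -
        (∑ i ∈ s, if V (T i x) < V x then c i else 0) * g x := by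
    rw [mapGenerator, Finset.sum_mul, ← Finset.sum_sub_distrib]
    refine Finset.sum_congr rfl fun i hi => ?_
    by_cases h : V (T i x) < V x
    · simp only [h, if_true]; ring
    · have : T i x = x := by by_contra hne; exact h (hV i hi hne)
      simp [this]
  by_cases hfix : ∀ i ∈ s, T i x = x
  · rw [hf hfix, mapGenerator]
    exact Finset.sum_eq_zero fun i hi => by rw [hfix i hi]; ring
  · push Not at hfix
    obtain ⟨i, hi, hne⟩ := hfix
    have hR : 0 < ∑ i ∈ s, if V (T i x) < V x then c i else 0 := by
      refine Finset.sum_pos' (fun j hj => ?_) ⟨i, hi, ?_⟩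
      · split_ifs
        exacts [(hc j hj).le, le_rfl]
      · rw [if_pos (hV i hi hne)]
        exact hc i hi
    rw [hG, hgx, mul_div_cancel₀ _ hR.ne']
    ring

/-- The recursion only looks forward along the maps, so it never leaves `A`. This controls the
support of `g` by quantities that the hops do not increase. -/
theorem poissonSolution_eq_zero (s : Finset ι) (T : ι → X → X) (c : ι → ℝ) (V : X → ℕ)
    (f : X → ℝ) (A : Set X) (hA : ∀ i ∈ s, ∀ x ∈ A, T i x ∈ A) (hf : ∀ x ∈ A, f x = 0)
    (x : X) (hx : x ∈ A) : poissonSolution s T c V f x = 0 := by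
  induction hn : V x using Nat.strong_induction_on generalizing x with
  | _ n ih =>
    rw [poissonSolution, hf x hx, Finset.sum_eq_zero, sub_zero, zero_div]
    intro i hi
    split_ifs with h
    · rw [ih _ (hn ▸ h) (T i x) (hA i hi x hx) rfl, mul_zero]
    · rfl

end FiniteChain

/-! ### Configurations on `ℤ`, windows and hops -/

/-- The configuration on `ℤ` in which exactly the sites up to `0` are occupied. -/
def stepConfig : ℤ → Bool := fun k => decide (k ≤ 0)

/-- The configuration that agrees with `ζ` on the sites `-m+1, ..., n` and with the step
configuration elsewhere. -/
def clip (m n : ℤ) (ζ : ℤ → Bool) : ℤ → Bool := fun k =>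
  if -m < k ∧ k ≤ n then ζ k else decide (k ≤ 0)

/-- The exclusion jump from site `i` to site `i + 1`. -/
def hop (i : ℤ) (ζ : ℤ → Bool) : ℤ → Bool := fun k =>
  if ζ i = true ∧ ζ (i + 1) = false then
    if k = i then false else if k = i + 1 then true else ζ k
  else ζ k

theorem hop_of_not {i : ℤ} {ζ : ℤ → Bool} (h : ¬(ζ i = true ∧ ζ (i + 1) = false)) :
    hop i ζ = ζ := by
  ext k
  simp [hop, h]

theorem clip_clip_of_le {m n m' n' : ℤ} (hm : m ≤ m') (hn : n ≤ n') (ζ : ℤ → Bool) :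
    clip m n (clip m' n' ζ) = clip m n ζ := by
  ext k
  simp only [clip]
  grind

@[simp] theorem clip_clip (m n : ℤ) (ζ : ℤ → Bool) : clip m n (clip m n ζ) = clip m n ζ :=
  clip_clip_of_le le_rfl le_rfl ζ

@[simp] theorem clip_stepConfig (m n : ℤ) : clip m n stepConfig = stepConfig := by
  ext k
  simp [clip, stepConfig]

theorem hop_stepConfig {i : ℤ} (hi : i ≠ 0) : hop i stepConfig = stepConfig := by
  apply hop_of_not
  simp only [stepConfig]
  grind

theorem clip_hop_clip {m n i : ℤ} (h1 : -m < i) (h2 : i < n) (ζ : ℤ → Bool) :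
    clip m n (hop i (clip m n ζ)) = clip m n (hop i ζ) := by
  ext k
  simp only [clip, hop]
  grind

theorem clip_hop_of_outside {m n i : ℤ} (h : i < -m ∨ n < i) (ζ : ℤ → Bool) :
    clip m n (hop i ζ) = clip m n ζ := by
  ext k
  simp only [clip, hop]
  grind

/-- The clipped configuration is always occupied at `-m`, so a window fed by a full reservoir
differs from the true dynamics exactly when `-m` is vacant. -/
theorem clip_hop_left {m n : ℤ} (hm : 1 ≤ m) (hn : 1 ≤ n) (ζ : ℤ → Bool) :
    clip m n (hop (-m) ζ) =
      if ζ (-m) = true then clip m n (hop (-m) (clip m n ζ)) else clip m n ζ := by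
  ext k
  split_ifs <;> simp only [clip, hop] <;> grind

theorem clip_hop_right {m n : ℤ} (hm : 1 ≤ m) (hn : 1 ≤ n) (ζ : ℤ → Bool) :
    clip m n (hop n ζ) =
      if ζ (n + 1) = false then clip m n (hop n (clip m n ζ)) else clip m n ζ := by
  ext k
  split_ifs <;> simp only [clip, hop] <;> grind

/-! ### Counting holes and particles; the potential -/

/-- The sum of weights `v k (ζ k)` over the sites `-M, ..., M + 1`. -/
noncomputable def weight (M : ℤ) (v : ℤ → Bool → ℕ) (ζ : ℤ → Bool) : ℕ :=
  ∑ k ∈ Finset.Icc (-M) (M + 1), v k (ζ k)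

theorem weight_hop {M i : ℤ} (v : ℤ → Bool → ℕ) (h1 : -M ≤ i) (h2 : i ≤ M) {ζ : ℤ → Bool}
    (h : ζ i = true ∧ ζ (i + 1) = false) :
    weight M v (hop i ζ) + v i true + v (i + 1) false =
      weight M v ζ + v i false + v (i + 1) true := by
  have hi : i ∈ Finset.Icc (-M) (M + 1) := Finset.mem_Icc.2 ⟨h1, by omega⟩
  have hj : i + 1 ∈ (Finset.Icc (-M) (M + 1)).erase i := by
    simp only [Finset.mem_erase, Finset.mem_Icc]
    omega
  unfold weight
  rw [← Finset.add_sum_erase _ _ hi, ← Finset.add_sum_erase _ _ hi,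
    ← Finset.add_sum_erase _ _ hj, ← Finset.add_sum_erase _ _ hj]
  have hrest : ∑ k ∈ ((Finset.Icc (-M) (M + 1)).erase i).erase (i + 1), v k (hop i ζ k) =
      ∑ k ∈ ((Finset.Icc (-M) (M + 1)).erase i).erase (i + 1), v k (ζ k) := by
    refine Finset.sum_congr rfl fun k hk => ?_
    simp only [Finset.mem_erase] at hk
    simp [hop, hk.1, hk.2.1]
  have e1 : hop i ζ i = false := by simp [hop, h]
  have e2 : hop i ζ (i + 1) = true := by simp [hop, h]
  rw [hrest, e1, e2, h.1, h.2]
  omega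

/-- Clipping replaces sites by their step values, which carry no weight. -/
theorem weight_clip_le (M : ℤ) {v : ℤ → Bool → ℕ} (hv : ∀ k, v k (decide (k ≤ 0)) = 0)
    (m n : ℤ) (ζ : ℤ → Bool) : weight M v (clip m n ζ) ≤ weight M v ζ := by
  refine Finset.sum_le_sum fun k _ => ?_
  simp only [clip]
  split_ifs
  · exact le_rfl
  · simp [hv]

/-- The number of vacant sites among `-M, ..., 0`. -/
noncomputable def leftHoles (M : ℤ) : (ℤ → Bool) → ℕ :=
  weight M fun k b => if k ≤ 0 ∧ b = false then 1 else 0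

/-- The number of occupied sites among `1, ..., M + 1`. -/
noncomputable def rightParticles (M : ℤ) : (ℤ → Bool) → ℕ :=
  weight M fun k b => if 0 < k ∧ b = true then 1 else 0

/-- The number of jumps after which the step configuration is reached, if none is made from site
`0` to site `1`, and holes leave at `-M` and particles at `M + 1`. -/
noncomputable def potential (M : ℤ) : (ℤ → Bool) → ℕ :=
  weight M fun k b => if k ≤ 0 then (if b then 0 else (k + M).toNat) else
    if b then (M + 1 - k).toNat else 0

theorem leftHoles_clip_le (M m n : ℤ) (ζ : ℤ → Bool) :
    leftHoles M (clip m n ζ) ≤ leftHoles M ζ :=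
  weight_clip_le M (by simp) m n ζ

theorem rightParticles_clip_le (M m n : ℤ) (ζ : ℤ → Bool) :
    rightParticles M (clip m n ζ) ≤ rightParticles M ζ :=
  weight_clip_le M (by simp) m n ζ

theorem potential_clip_le (M m n : ℤ) (ζ : ℤ → Bool) :
    potential M (clip m n ζ) ≤ potential M ζ :=
  weight_clip_le M (by intro k; by_cases h : k ≤ 0 <;> simp [h]) m n ζ

theorem leftHoles_stepConfig (M : ℤ) : leftHoles M stepConfig = 0 := by
  unfold leftHoles weight
  refine Finset.sum_eq_zero fun k _ => ?_
  simp [stepConfig]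

theorem rightParticles_stepConfig (M : ℤ) : rightParticles M stepConfig = 0 := by
  unfold rightParticles weight
  refine Finset.sum_eq_zero fun k _ => ?_
  simp [stepConfig]

theorem leftHoles_hop_le {M i : ℤ} (h1 : -M ≤ i) (h2 : i ≤ M) (h0 : i ≠ 0) (ζ : ℤ → Bool) :
    leftHoles M (hop i ζ) ≤ leftHoles M ζ := by
  by_cases h : ζ i = true ∧ ζ (i + 1) = false
  · have := weight_hop (fun k b => if k ≤ 0 ∧ b = false then 1 else 0) h1 h2 h
    unfold leftHoles
    grind
  · rw [hop_of_not h]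

theorem rightParticles_hop_le {M i : ℤ} (h1 : -M ≤ i) (h2 : i ≤ M) (h0 : i ≠ 0)
    (ζ : ℤ → Bool) : rightParticles M (hop i ζ) ≤ rightParticles M ζ := by
  by_cases h : ζ i = true ∧ ζ (i + 1) = false
  · have := weight_hop (fun k b => if 0 < k ∧ b = true then 1 else 0) h1 h2 h
    unfold rightParticles
    grind
  · rw [hop_of_not h]

theorem leftHoles_hop_zero_le {M : ℤ} (hM : 0 ≤ M) (ζ : ℤ → Bool) :
    leftHoles M (hop 0 ζ) ≤ leftHoles M ζ + 1 := by
  by_cases h : ζ 0 = true ∧ ζ (0 + 1) = false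
  · have := weight_hop (fun k b => if k ≤ 0 ∧ b = false then 1 else 0)
      (Int.neg_nonpos_of_nonneg hM) hM h
    unfold leftHoles
    grind
  · rw [hop_of_not h]
    exact Nat.le_succ _

theorem rightParticles_hop_zero_le {M : ℤ} (hM : 0 ≤ M) (ζ : ℤ → Bool) :
    rightParticles M (hop 0 ζ) ≤ rightParticles M ζ + 1 := by
  by_cases h : ζ 0 = true ∧ ζ (0 + 1) = false
  · have := weight_hop (fun k b => if 0 < k ∧ b = true then 1 else 0)
      (Int.neg_nonpos_of_nonneg hM) hM h
    unfold rightParticles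
    grind
  · rw [hop_of_not h]
    exact Nat.le_succ _

theorem potential_hop_lt {M i : ℤ} (h1 : -M ≤ i) (h2 : i ≤ M) (h0 : i ≠ 0) {ζ : ℤ → Bool}
    (hne : hop i ζ ≠ ζ) : potential M (hop i ζ) < potential M ζ := by
  by_cases h : ζ i = true ∧ ζ (i + 1) = false
  · have := weight_hop (fun k b => if k ≤ 0 then (if b then 0 else (k + M).toNat) else
      if b then (M + 1 - k).toNat else 0) h1 h2 h
    unfold potential
    rcases lt_or_gt_of_ne h0 with h0 | h0
    · have h3 : i ≤ 0 := h0.le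
      have h4 : i + 1 ≤ 0 := h0
      simp only [h3, h4, if_true, Bool.false_eq_true, if_false] at this
      omega
    · have h3 : ¬ i ≤ 0 := by omega
      have h4 : ¬ i + 1 ≤ 0 := by omega
      simp only [h3, h4, if_true, Bool.false_eq_true, if_false] at this
      omega
  · exact absurd (hop_of_not h) hne

/-- A hole at `-m` adds to the holes in the window `-m+1, ..., n`. -/
theorem leftHoles_clip_lt {M m n : ℤ} (hm : 0 ≤ m) (hmM : m ≤ M) (hn : 0 ≤ n) {ζ : ℤ → Bool}
    (h : ζ (-m) = false) : leftHoles M (clip m n ζ) < leftHoles M (clip (m + 1) n ζ) := by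
  refine Finset.sum_lt_sum (fun k _ => ?_) ⟨-m, Finset.mem_Icc.2 (by omega), ?_⟩
  · simp only [clip]
    grind
  · simp only [clip]
    grind

/-- A particle at `n + 1` adds to the particles in the window `-m+1, ..., n`. -/
theorem rightParticles_clip_lt {M m n : ℤ} (hm : 0 ≤ m) (hn : 0 ≤ n) (hnM : n ≤ M)
    {ζ : ℤ → Bool} (h : ζ (n + 1) = true) :
    rightParticles M (clip m n ζ) < rightParticles M (clip m (n + 1) ζ) := by
  refine Finset.sum_lt_sum (fun k _ => ?_) ⟨n + 1, Finset.mem_Icc.2 (by omega), ?_⟩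
  · simp only [clip]
    grind
  · simp only [clip]
    grind

/-- Occupation propagates rightwards from the full site `-m` up to `0`, and vacancy leftwards from
the empty site `n + 1` down to `1`. -/
theorem eq_stepConfig_of_fixed {m n : ℤ} (hm : 1 ≤ m) (hn : 1 ≤ n) {ζ : ℤ → Bool}
    (hζ : clip m n ζ = ζ)
    (h : ∀ i ∈ (Finset.Icc (-m) n).erase 0, clip m n (hop i ζ) = ζ) : ζ = stepConfig := by
  have hout : ∀ k, ¬(-m < k ∧ k ≤ n) → ζ k = decide (k ≤ 0) := by
    intro k hk
    rw [← hζ, clip, if_neg hk]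
  have hfix : ∀ i, -m ≤ i → i ≤ n → i ≠ 0 → ζ i = true → ζ (i + 1) = true := by
    intro i h1 h2 h0 hi
    by_contra hj
    rw [Bool.not_eq_true] at hj
    have h3 := h i (by simp only [Finset.mem_erase, Finset.mem_Icc]; omega)
    by_cases h4 : -m < i
    · have h5 := congrFun h3 i
      simp [clip, hop, h4, h2, hi, hj] at h5
    · have h5 := congrFun h3 (i + 1)
      have h6 : -m < i + 1 := by omega
      have h7 : i + 1 ≤ n := by omega
      simp [clip, hop, h6, h7, hi, hj] at h5
  have hleft : ∀ k, -m ≤ k → k ≤ 0 → ζ k = true := by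
    intro k hk
    induction k, hk using Int.leInduction with
    | base => intro _; rw [hout _ (by omega)]; simpa using by omega
    | succ k hk ih => intro h0; exact hfix k hk (by omega) (by omega) (ih (by omega))
  have hright : ∀ k, k ≤ n + 1 → 1 ≤ k → ζ k = false := by
    intro k hk
    induction k, hk using Int.leInductionDown with
    | base => intro _; rw [hout _ (by omega)]; simpa using by omega
    | pred k hk ih =>
      intro h0
      by_contra hc
      rw [Bool.not_eq_false] at hc
      by_cases h1 : -m ≤ k - 1
      · have := hfix (k - 1) h1 (by omega) (by omega) hc
        rw [sub_add_cancel, ih (by omega)] at this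
        exact absurd this (by simp)
      · omega
  ext k
  by_cases hk : -m < k ∧ k ≤ n
  · by_cases h0 : k ≤ 0
    · rw [hleft k hk.1.le h0, stepConfig, decide_eq_true h0]
    · rw [hright k (by omega) (by omega), stepConfig, decide_eq_false h0]
  · rw [hout k hk, stepConfig]

/-! ### The Poisson equation in a window -/

/-- The Poisson equation in a window, without jumps from site `0` to site `1`. -/
theorem exists_window_solution {m n : ℤ} (hm : 1 ≤ m) (hn : 1 ≤ n) (c : ℤ → ℝ)
    (hc : ∀ i, i ≠ 0 → 0 < c i) (f : (ℤ → Bool) → ℝ) (hf : f stepConfig = 0) :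
    ∃ g : (ℤ → Bool) → ℝ,
      (∀ ζ, clip m n ζ = ζ →
        ∑ i ∈ (Finset.Icc (-m) n).erase 0, c i * (g (clip m n (hop i ζ)) - g ζ) = f ζ) ∧
      ∀ A : Set (ℤ → Bool),
        (∀ i ∈ (Finset.Icc (-m) n).erase 0, ∀ ζ ∈ A, clip m n (hop i ζ) ∈ A) →
        (∀ ζ ∈ A, f ζ = 0) → ∀ ζ ∈ A, g ζ = 0 := by
  refine ⟨poissonSolution ((Finset.Icc (-m) n).erase 0) (fun i ζ => clip m n (hop i ζ)) c
    (potential (max m n)) f, fun ζ hζ => ?_, fun A hA hfA ζ hζ => ?_⟩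
  · refine mapGenerator_poissonSolution _ (fun i ζ => clip m n (hop i ζ)) c
      (fun i hi => hc i (Finset.ne_of_mem_erase hi)) _ f ζ (fun i hi hne => ?_) fun h => ?_
    · simp only [Finset.mem_erase, Finset.mem_Icc] at hi
      refine (potential_clip_le _ m n _).trans_lt (potential_hop_lt (by omega) (by omega) hi.1 ?_)
      intro h
      exact hne (by simp only [h, hζ])
    · rw [eq_stepConfig_of_fixed hm hn hζ h, hf]
  · exact poissonSolution_eq_zero _ (fun i ζ => clip m n (hop i ζ)) c _ f A hA hfA ζ hζ

/-! ### The process as hops on `ℤ` -/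

/-- The extension of a configuration by full sites on the left and vacant sites on the right. -/
noncomputable def extend (L : ℕ) (η : Config L) : ℤ → Bool := fun k =>
  if h : k ∈ Finset.Icc (1 - (L : ℤ)) (L : ℤ) then η ⟨k, h⟩ else decide (k ≤ 0)

/-- The restriction of a configuration on `ℤ` to the sites `-L+1, ..., L`. -/
def restrict (L : ℕ) (ζ : ℤ → Bool) : Config L := fun k => ζ k

/-- The rates of the jumps to `-L+1` from the left, between the sites, and to the right from `L`. -/
noncomputable def rate (L : ℕ) (a r : ℝ) (i : ℤ) : ℝ :=
  if i = 0 then r else if i = -L ∨ i = L then a else 1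

theorem rate_pos (L : ℕ) {a r : ℝ} (ha : 0 < a) (hr : 0 < r) (i : ℤ) : 0 < rate L a r i := by
  unfold rate
  split_ifs
  exacts [hr, ha, one_pos]

theorem extend_restrict (L : ℕ) (ζ : ℤ → Bool) : extend L (restrict L ζ) = clip L L ζ := by
  ext k
  simp only [extend, restrict, clip, Finset.mem_Icc]
  grind

theorem restrict_extend (L : ℕ) (η : Config L) : restrict L (extend L η) = η := by
  ext k
  simp only [extend, restrict, k.2, dif_pos]

theorem clip_extend (L : ℕ) (η : Config L) : clip L L (extend L η) = extend L η := by
  rw [← extend_restrict, restrict_extend]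

theorem restrict_hop_extend_left {L : ℕ} (hL : 1 ≤ L) (η : Config L) (i : Site L)
    (hi : (i : ℤ) = 1 - (L : ℤ)) :
    restrict L (hop (-L) (extend L η)) = Function.update η i true := by
  obtain ⟨i, hmem⟩ := i
  simp only at hi
  subst hi
  ext ⟨k, hk⟩
  simp only [restrict, hop, extend, Function.update_apply, Subtype.mk.injEq, Finset.mem_Icc] at *
  grind

theorem restrict_hop_extend_right {L : ℕ} (hL : 1 ≤ L) (η : Config L) (i : Site L)
    (hi : (i : ℤ) = L) :
    restrict L (hop L (extend L η)) = Function.update η i false := by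
  obtain ⟨i, hmem⟩ := i
  simp only at hi
  subst hi
  ext ⟨k, hk⟩
  simp only [restrict, hop, extend, Function.update_apply, Subtype.mk.injEq, Finset.mem_Icc] at *
  grind

theorem restrict_hop_extend {L : ℕ} (η : Config L) (i j : Site L)
    (hij : (j : ℤ) = i + 1) : restrict L (hop i (extend L η)) = jump i j η := by
  obtain ⟨i, hi⟩ := i
  obtain ⟨j, hj⟩ := j
  simp only at hij
  subst hij
  ext ⟨k, hk⟩
  simp only [restrict, hop, extend, jump, Subtype.mk.injEq, hi, hj, hk, dif_pos]
  grind

theorem sum_site_ite (L : ℕ) {k : ℤ} (hk : k ∈ Finset.Icc (1 - (L : ℤ)) (L : ℤ)) (F : Site L → ℝ) :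
    (∑ i : Site L, if (i : ℤ) = k then F i else 0) = F ⟨k, hk⟩ := by
  rw [Finset.sum_eq_single ⟨k, hk⟩]
  · simp
  · intro b _ hb
    rw [if_neg]
    exact fun h => hb (Subtype.ext h)
  · exact fun h => absurd (Finset.mem_univ _) h

theorem generator_eq {L : ℕ} (hL : 1 ≤ L) (a r : ℝ) (f : Config L → ℝ) (η : Config L) :
    generator L a a r f η =
      mapGenerator (Finset.Icc (-(L : ℤ)) L) (fun i η => restrict L (hop i (extend L η)))
        (rate L a r) f η := by
  have hl : 1 - (L : ℤ) ∈ Finset.Icc (1 - (L : ℤ)) (L : ℤ) := Finset.mem_Icc.2 (by omega)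
  have hr : (L : ℤ) ∈ Finset.Icc (1 - (L : ℤ)) (L : ℤ) := Finset.mem_Icc.2 (by omega)
  rw [generator, sum_site_ite L hl, sum_site_ite L hr,
    ← restrict_hop_extend_left hL η ⟨_, hl⟩ rfl, ← restrict_hop_extend_right hL η ⟨_, hr⟩ rfl]
  have hmid : (∑ i : Site L, ∑ j : Site L, if (j : ℤ) = (i : ℤ) + 1 then
      bondRate r i * (f (jump i j η) - f η) else 0) =
      ∑ i ∈ Finset.Ico (1 - (L : ℤ)) L,
        rate L a r i * (f (restrict L (hop i (extend L η))) - f η) := by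
    have h1 : ∀ i : Site L, (∑ j : Site L, if (j : ℤ) = (i : ℤ) + 1 then
        bondRate r i * (f (jump i j η) - f η) else 0) =
        if (i : ℤ) < L then
          rate L a r i * (f (restrict L (hop i (extend L η))) - f η) else 0 := by
      intro i
      have hi := Finset.mem_Icc.1 i.2
      split_ifs with h
      · have hj : (i : ℤ) + 1 ∈ Finset.Icc (1 - (L : ℤ)) (L : ℤ) := Finset.mem_Icc.2 (by omega)
        rw [sum_site_ite L hj (fun j => bondRate r i * (f (jump i j η) - f η)),
          restrict_hop_extend η i ⟨_, hj⟩ rfl]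
        congr 1
        have h2 : ¬((i : ℤ) = -L ∨ (i : ℤ) = L) := by omega
        simp only [bondRate, rate, h2, if_false]
      · refine Finset.sum_eq_zero fun j _ => if_neg ?_
        have := Finset.mem_Icc.1 j.2
        omega
    rw [Finset.sum_congr rfl fun i _ => h1 i, Finset.sum_coe_sort (Finset.Icc (1 - (L : ℤ)) L)
      (fun i : ℤ => if i < L then
        rate L a r i * (f (restrict L (hop i (extend L η))) - f η) else 0), ← Finset.sum_filter]
    congr 1
    ext i
    simp only [Finset.mem_filter, Finset.mem_Icc, Finset.mem_Ico]
    omega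
  have hIcc : Finset.Icc (-(L : ℤ)) L =
      insert (-(L : ℤ)) (insert (L : ℤ) (Finset.Ico (1 - (L : ℤ)) L)) := by
    ext i
    simp only [Finset.mem_insert, Finset.mem_Icc, Finset.mem_Ico]
    omega
  have h0 : L ≠ 0 := by omega
  rw [hmid, mapGenerator, hIcc, Finset.sum_insert, Finset.sum_insert]
  · have e1 : rate L a r (-L) = a := by simp [rate, h0]
    have e2 : rate L a r L = a := by simp [rate, h0]
    rw [e1, e2]
    ring
  · simp
  · simp only [Finset.mem_insert, Finset.mem_Ico]
    omega

/-- The step configuration is reachable from everywhere: any other configuration admits a hop off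
the blockage that lowers `potential`. -/
theorem existsUnique_isStationary {L : ℕ} (hL : 1 ≤ L) {a r : ℝ} (ha : 0 < a) (hr : 0 < r) :
    ∃! p : Config L → ℝ, IsStationary L a a r p := by
  unfold IsStationary
  simp only [generator_eq hL]
  refine existsUnique_stationary _ _ _ (fun i _ => rate_pos L ha hr i)
    (restrict L stepConfig) fun A hA hcl => ?_
  classical
  obtain ⟨η, hη⟩ := hA
  induction hn : potential L (extend L η) using Nat.strong_induction_on generalizing η with
  | _ n ih =>
    by_cases h : ∀ i ∈ (Finset.Icc (-(L : ℤ)) L).erase 0,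
        clip L L (hop i (extend L η)) = extend L η
    · have := eq_stepConfig_of_fixed (by omega) (by omega) (clip_extend L η) h
      rwa [← this, restrict_extend]
    · push Not at h
      obtain ⟨i, hi, hne⟩ := h
      simp only [Finset.mem_erase, Finset.mem_Icc] at hi
      refine ih _ ?_ _ (hcl i (Finset.mem_Icc.2 hi.2) η hη) rfl
      rw [extend_restrict, ← hn]
      refine (potential_clip_le _ _ _ _).trans_lt (potential_hop_lt hi.2.1 hi.2.2 hi.1 ?_)
      intro h
      exact hne (by rw [h, clip_extend])

/-! ### Stationary expectations and a priori bounds -/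

/-- The expectation in the state `p` of a function of the extended configuration. -/
noncomputable def expect (L : ℕ) (p : Config L → ℝ) (F : (ℤ → Bool) → ℝ) : ℝ :=
  ∑ η, p η * F (extend L η)

theorem expect_sub (L : ℕ) (p : Config L → ℝ) (F G : (ℤ → Bool) → ℝ) :
    expect L p (fun ζ => F ζ - G ζ) = expect L p F - expect L p G := by
  simp only [expect, mul_sub, Finset.sum_sub_distrib]

theorem expect_add (L : ℕ) (p : Config L → ℝ) (F G : (ℤ → Bool) → ℝ) :
    expect L p (fun ζ => F ζ + G ζ) = expect L p F + expect L p G := by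
  simp only [expect, mul_add, Finset.sum_add_distrib]

theorem expect_const_mul (L : ℕ) (p : Config L → ℝ) (c : ℝ) (F : (ℤ → Bool) → ℝ) :
    expect L p (fun ζ => c * F ζ) = c * expect L p F := by
  simp only [expect, Finset.mul_sum]
  exact Finset.sum_congr rfl fun _ _ => by ring

theorem expect_const {L : ℕ} {p : Config L → ℝ} (hp : p ∈ stdSimplex ℝ (Config L)) (c : ℝ) :
    expect L p (fun _ => c) = c := by
  rw [expect, ← Finset.sum_mul, hp.2, one_mul]

theorem abs_expect_le {L : ℕ} {p : Config L → ℝ} (hp : p ∈ stdSimplex ℝ (Config L))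
    (F : (ℤ → Bool) → ℝ) : |expect L p F| ≤ ∑ η, |F (extend L η)| := by
  refine (Finset.abs_sum_le_sum_abs _ _).trans (Finset.sum_le_sum fun η _ => ?_)
  rw [abs_mul, abs_of_nonneg (hp.1 η)]
  have h1 : p η ≤ 1 := hp.2 ▸ Finset.single_le_sum (fun i _ => hp.1 i) (Finset.mem_univ η)
  exact mul_le_of_le_one_left (abs_nonneg _) h1

/-- Stationarity for functions of the configuration in a window. -/
theorem IsStationary.expect_window {L : ℕ} (hL : 1 ≤ L) {a r : ℝ} {p : Config L → ℝ}
    (hp : IsStationary L a a r p) {m n : ℤ} (hm : m ≤ L) (hn : n ≤ L)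
    (g : (ℤ → Bool) → ℝ) :
    expect L p (fun ζ => ∑ i ∈ Finset.Icc (-m) n,
      rate L a r i * (g (clip m n (hop i ζ)) - g (clip m n ζ))) = 0 := by
  rw [← hp.2 (fun η => g (clip m n (extend L η))), expect]
  refine Finset.sum_congr rfl fun η _ => ?_
  rw [generator_eq hL, mapGenerator]
  congr 1
  refine Finset.sum_subset_zero_on_sdiff
    (Finset.Icc_subset_Icc (by omega) hn) (fun i hi => ?_) fun i hi => ?_
  · simp only [Finset.mem_sdiff, Finset.mem_Icc] at hi
    rw [extend_restrict, clip_clip_of_le hm hn, clip_hop_of_outside (by omega), sub_self, mul_zero]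
  · rw [extend_restrict, clip_clip_of_le hm hn]

theorem rate_of_ne {L : ℕ} {a r : ℝ} {i : ℤ} (hi : i ≠ 0) : rate L a r i = rate L a 1 i := by
  simp only [rate, hi, if_false]

theorem rate_of_lt {L : ℕ} {a r : ℝ} {i : ℤ} (hi : i ≠ 0) (h1 : -(L : ℤ) < i) (h2 : i < L) :
    rate L a r i = 1 := by
  have h : ¬(i = -(L : ℤ) ∨ i = L) := by omega
  simp only [rate, hi, h, if_false]

theorem expect_congr {L : ℕ} (p : Config L → ℝ) {F G : (ℤ → Bool) → ℝ}
    (h : ∀ ζ, clip L L ζ = ζ → F ζ = G ζ) : expect L p F = expect L p G :=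
  Finset.sum_congr rfl fun η _ => by rw [h _ (clip_extend L η)]

theorem expect_isBigO_one {L : ℕ} {a : ℝ} {p : ℝ → Config L → ℝ}
    (hp : ∀ r, 0 < r → IsStationary L a a r (p r)) (f : (ℤ → Bool) → ℝ) :
    (fun r => expect L (p r) f) =O[𝓝[>] (0 : ℝ)] fun _ => (1 : ℝ) := by
  refine IsBigO.of_bound (∑ η, |f (extend L η)|) ?_
  filter_upwards [self_mem_nhdsWithin] with r hr
  rw [norm_one, mul_one]
  exact abs_expect_le (hp r hr).1 f

theorem isBigO_mul_pow {F : ℝ → ℝ} {k : ℕ} (h : F =O[𝓝[>] (0 : ℝ)] fun r => r ^ k) :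
    (fun r => r * F r) =O[𝓝[>] (0 : ℝ)] fun r => r ^ (k + 1) := by
  simp only [pow_succ']
  exact (isBigO_refl _ _).mul h

/-- If the jumps other than the one across the blockage do not increase `N`, and that one increases
it by at most one, then the stationary state gives `k ≤ N` a probability of order `r ^ k`. -/
theorem expect_isBigO_pow {L : ℕ} (hL : 1 ≤ L) {a : ℝ} (ha : 0 < a) {p : ℝ → Config L → ℝ}
    (hp : ∀ r, 0 < r → IsStationary L a a r (p r)) (N : (ℤ → Bool) → ℕ)
    (hN : ∀ i ∈ (Finset.Icc (-(L : ℤ)) L).erase 0, ∀ ζ, N (clip L L (hop i ζ)) ≤ N ζ)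
    (hN0 : ∀ ζ, N (clip L L (hop 0 ζ)) ≤ N ζ + 1) (hNs : N stepConfig = 0) (k : ℕ)
    (f : (ℤ → Bool) → ℝ) (hf : ∀ ζ, f ζ ≠ 0 → k ≤ N ζ) :
    (fun r => expect L (p r) f) =O[𝓝[>] (0 : ℝ)] fun r => r ^ k := by
  induction k generalizing f with
  | zero => simpa using expect_isBigO_one hp f
  | succ k ih =>
    have hfs : f stepConfig = 0 := by
      by_contra h
      have := hf _ h
      omega
    -- The window is the whole system, so there are no defects: stationarity gives `E f = -r E (g ∘
    -- hop 0 - g)`, up to clipping.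
    obtain ⟨g, hg, hgA⟩ := exists_window_solution (m := L) (n := L) (by omega) (by omega)
      (rate L a 1) (fun i _ => rate_pos L ha one_pos i) f hfs
    have hg0 : ∀ ζ, g ζ ≠ 0 → k + 1 ≤ N ζ := by
      intro ζ hζ
      by_contra hlt
      refine hζ (hgA {ζ | N ζ < k + 1} (fun i hi ζ h => (hN i hi ζ).trans_lt h) (fun ζ h => ?_) ζ
        (not_le.1 hlt))
      by_contra hne
      exact absurd (hf ζ hne) (not_le.2 h)
    -- `g` lives on `k + 1 ≤ N` and the blockage jump raises `N` by at most one, so this difference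
    -- lives on `k ≤ N`.
    have key := ih (fun ζ => g (clip L L (hop 0 ζ)) - g ζ) fun ζ hζ => by
      by_cases h : g ζ = 0
      · have h' : g (clip L L (hop 0 ζ)) ≠ 0 := by
          intro h'
          exact hζ (by simp only [h, h', sub_zero])
        have := hg0 _ h'
        have := hN0 ζ
        omega
      · exact (Nat.le_succ k).trans (hg0 ζ h)
    refine (isBigO_mul_pow key).neg_left.congr' ?_ EventuallyEq.rfl
    filter_upwards [self_mem_nhdsWithin] with r hr
    have h := (hp r hr).expect_window hL le_rfl le_rfl g
    have hsplit := expect_congr (p r) (F := fun ζ => ∑ i ∈ Finset.Icc (-(L : ℤ)) L,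
        rate L a r i * (g (clip L L (hop i ζ)) - g (clip L L ζ)))
      (G := fun ζ => r * (g (clip L L (hop 0 ζ)) - g ζ) + f ζ) fun ζ hζ => by
        have h0 : (0 : ℤ) ∈ Finset.Icc (-(L : ℤ)) L := Finset.mem_Icc.2 (by omega)
        have e0 : rate L a r 0 = r := if_pos rfl
        rw [← Finset.add_sum_erase _ _ h0, hζ, ← hg ζ hζ, e0]
        refine congrArg₂ _ rfl (Finset.sum_congr rfl fun i hi => ?_)
        rw [rate_of_ne (Finset.ne_of_mem_erase hi)]
    rw [hsplit, expect_add, expect_const_mul] at h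
    linarith

theorem expect_isBigO_of_leftHoles {L : ℕ} (hL : 1 ≤ L) {a : ℝ} (ha : 0 < a)
    {p : ℝ → Config L → ℝ} (hp : ∀ r, 0 < r → IsStationary L a a r (p r)) {M : ℤ} (hM : L ≤ M)
    (k : ℕ) (f : (ℤ → Bool) → ℝ) (hf : ∀ ζ, f ζ ≠ 0 → k ≤ leftHoles M ζ) :
    (fun r => expect L (p r) f) =O[𝓝[>] (0 : ℝ)] fun r => r ^ k := by
  refine expect_isBigO_pow hL ha hp (leftHoles M) (fun i hi ζ => ?_)
    (fun ζ => (leftHoles_clip_le M L L _).trans (leftHoles_hop_zero_le (by omega) ζ))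
    (leftHoles_stepConfig M) k f hf
  simp only [Finset.mem_erase, Finset.mem_Icc] at hi
  exact (leftHoles_clip_le M L L _).trans (leftHoles_hop_le (by omega) (by omega) hi.1 ζ)

theorem expect_isBigO_of_rightParticles {L : ℕ} (hL : 1 ≤ L) {a : ℝ} (ha : 0 < a)
    {p : ℝ → Config L → ℝ} (hp : ∀ r, 0 < r → IsStationary L a a r (p r)) {M : ℤ} (hM : L ≤ M)
    (k : ℕ) (f : (ℤ → Bool) → ℝ) (hf : ∀ ζ, f ζ ≠ 0 → k ≤ rightParticles M ζ) :
    (fun r => expect L (p r) f) =O[𝓝[>] (0 : ℝ)] fun r => r ^ k := by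
  refine expect_isBigO_pow hL ha hp (rightParticles M) (fun i hi ζ => ?_)
    (fun ζ => (rightParticles_clip_le M L L _).trans (rightParticles_hop_zero_le (by omega) ζ))
    (rightParticles_stepConfig M) k f hf
  simp only [Finset.mem_erase, Finset.mem_Icc] at hi
  exact (rightParticles_clip_le M L L _).trans
    (rightParticles_hop_le (by omega) (by omega) hi.1 ζ)

/-- The step can be left only across the blockage, so the indicator of being off the step is an
admissible `N`. This covers the case in which `max 1` does not provide an actual hole or particle.
-/
theorem expect_isBigO_of_stepConfig {L : ℕ} (hL : 1 ≤ L) {a : ℝ} (ha : 0 < a)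
    {p : ℝ → Config L → ℝ} (hp : ∀ r, 0 < r → IsStationary L a a r (p r))
    {k : ℕ} (hk : k ≤ 1) (f : (ℤ → Bool) → ℝ) (hf : f stepConfig = 0) :
    (fun r => expect L (p r) f) =O[𝓝[>] (0 : ℝ)] fun r => r ^ k := by
  classical
  refine expect_isBigO_pow hL ha hp (fun ζ => if ζ = stepConfig then 0 else 1)
    (fun i hi ζ => ?_) (fun ζ => ?_) (if_pos rfl) k f fun ζ hζ => ?_
  · by_cases h : ζ = stepConfig
    · simp [h, hop_stepConfig (Finset.ne_of_mem_erase hi)]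
    · simp only [h, if_false]
      split_ifs <;> omega
  · split_ifs <;> omega
  · have : ζ ≠ stepConfig := fun h => hζ (h ▸ hf)
    simpa only [this, if_false] using hk

/-- The bound for a function of a window whose support forces many holes or many particles. -/
theorem expect_clip_isBigO {L : ℕ} (hL : 1 ≤ L) {a : ℝ} (ha : 0 < a)
    {p : ℝ → Config L → ℝ} (hp : ∀ r, 0 < r → IsStationary L a a r (p r)) {M : ℤ} (hM : L ≤ M)
    (k : ℕ) (m n : ℤ) (f : (ℤ → Bool) → ℝ) (hfs : f stepConfig = 0)
    (hf : (∀ ζ, f ζ ≠ 0 → k ≤ max 1 (leftHoles M ζ)) ∨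
      ∀ ζ, f ζ ≠ 0 → k ≤ max 1 (rightParticles M ζ)) :
    (fun r => expect L (p r) fun ζ => f (clip m n ζ)) =O[𝓝[>] (0 : ℝ)] fun r => r ^ k := by
  rcases le_or_gt k 1 with hk | hk
  · exact expect_isBigO_of_stepConfig hL ha hp hk _ (by rw [clip_stepConfig, hfs])
  · rcases hf with hf | hf
    · refine expect_isBigO_of_leftHoles hL ha hp hM k _ fun ζ hζ => ?_
      have := hf _ hζ
      have := leftHoles_clip_le M m n ζ
      omega
    · refine expect_isBigO_of_rightParticles hL ha hp hM k _ fun ζ hζ => ?_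
      have := hf _ hζ
      have := rightParticles_clip_le M m n ζ
      omega

/-! ### Windows inside the system: defects and comparison -/

/-- The effect of a vacancy at `-m` on the entrance of particles into the window. -/
def leftDefect (m n : ℤ) (g : (ℤ → Bool) → ℝ) (ζ : ℤ → Bool) : ℝ :=
  if ζ (-m) = true then 0 else g (clip m n (hop (-m) (clip m n ζ))) - g (clip m n ζ)

/-- The effect of a particle at `n + 1` on the exit of particles from the window. -/
def rightDefect (m n : ℤ) (g : (ℤ → Bool) → ℝ) (ζ : ℤ → Bool) : ℝ :=
  if ζ (n + 1) = false then 0 else g (clip m n (hop n (clip m n ζ))) - g (clip m n ζ)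

theorem leftDefect_clip {m n : ℤ} (hm : 1 ≤ m) (hn : 1 ≤ n) (g : (ℤ → Bool) → ℝ)
    (ζ : ℤ → Bool) : leftDefect m n g (clip (m + 1) n ζ) = leftDefect m n g ζ := by
  have h : clip (m + 1) n ζ (-m) = ζ (-m) := if_pos (by omega)
  simp only [leftDefect, h, clip_clip_of_le (show m ≤ m + 1 by omega) (le_refl n)]

theorem rightDefect_clip {m n : ℤ} (hm : 1 ≤ m) (hn : 1 ≤ n) (g : (ℤ → Bool) → ℝ)
    (ζ : ℤ → Bool) : rightDefect m n g (clip m (n + 1) ζ) = rightDefect m n g ζ := by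
  have h : clip m (n + 1) ζ (n + 1) = ζ (n + 1) := if_pos (by omega)
  simp only [rightDefect, h, clip_clip_of_le (le_refl m) (show n ≤ n + 1 by omega)]

/-- An entrance is missed only if it was possible, so the entry site `-m + 1` is vacant as well as
`-m`. -/
theorem leftDefect_ne_zero {m n : ℤ} (hm : 1 ≤ m) {g : (ℤ → Bool) → ℝ}
    {ζ : ℤ → Bool} (h : leftDefect m n g ζ ≠ 0) : ζ (-m) = false ∧ ζ (-(m - 1)) = false ∧
      g (clip m n (hop (-m) (clip m n ζ))) - g (clip m n ζ) ≠ 0 := by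
  by_cases h0 : ζ (-m) = true
  · exact absurd (if_pos h0) h
  · rw [leftDefect, if_neg h0] at h
    refine ⟨by simpa using h0, ?_, h⟩
    by_contra h1
    apply h
    rw [hop_of_not, clip_clip, sub_self]
    simp only [clip]
    grind

theorem rightDefect_ne_zero {m n : ℤ} (hn : 1 ≤ n) {g : (ℤ → Bool) → ℝ}
    {ζ : ℤ → Bool} (h : rightDefect m n g ζ ≠ 0) : ζ (n + 1) = true ∧ ζ (n - 1 + 1) = true ∧
      g (clip m n (hop n (clip m n ζ))) - g (clip m n ζ) ≠ 0 := by
  by_cases h0 : ζ (n + 1) = false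
  · exact absurd (if_pos h0) h
  · rw [rightDefect, if_neg h0] at h
    refine ⟨by simpa using h0, ?_, h⟩
    by_contra h1
    apply h
    rw [hop_of_not, clip_clip, sub_self]
    simp only [clip]
    grind

/-- In a window inside the system, stationarity expresses the expectation of `f` through the jumps
across the blockage and through larger windows. -/
theorem IsStationary.expect_clip_eq {L : ℕ} (hL : 1 ≤ L) {a r : ℝ} {p : Config L → ℝ}
    (hp : IsStationary L a a r p) {m n : ℤ} (hm : 1 ≤ m) (hn : 1 ≤ n) (hmL : m < L) (hnL : n < L)
    (f g : (ℤ → Bool) → ℝ)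
    (hg : ∀ ζ, clip m n ζ = ζ →
      ∑ i ∈ (Finset.Icc (-m) n).erase 0, (1 : ℝ) * (g (clip m n (hop i ζ)) - g ζ) = f ζ) :
    expect L p (fun ζ => f (clip m n ζ)) =
      -(r * expect L p fun ζ => g (clip m n (hop 0 (clip m n ζ))) - g (clip m n ζ)) +
        ((expect L p fun ζ => leftDefect m n g (clip (m + 1) n ζ)) +
          expect L p fun ζ => rightDefect m n g (clip m (n + 1) ζ)) := by
  have h := hp.expect_window hL hmL.le hnL.le g
  have hsplit := expect_congr p (F := fun ζ => ∑ i ∈ Finset.Icc (-m) n,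
      rate L a r i * (g (clip m n (hop i ζ)) - g (clip m n ζ)))
    (G := fun ζ => r * (g (clip m n (hop 0 (clip m n ζ))) - g (clip m n ζ)) + (f (clip m n ζ) -
      (leftDefect m n g (clip (m + 1) n ζ) + rightDefect m n g (clip m (n + 1) ζ)))) fun ζ _ => by
      have h0 : (0 : ℤ) ∈ Finset.Icc (-m) n := Finset.mem_Icc.2 (by omega)
      have hl : -m ∈ (Finset.Icc (-m) n).erase 0 :=
        Finset.mem_erase.2 ⟨by omega, Finset.mem_Icc.2 (by omega)⟩
      have hr : n ∈ (Finset.Icc (-m) n).erase 0 :=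
        Finset.mem_erase.2 ⟨by omega, Finset.mem_Icc.2 (by omega)⟩
      have hterm : ∀ i ∈ (Finset.Icc (-m) n).erase 0,
          rate L a r i * (g (clip m n (hop i ζ)) - g (clip m n ζ)) =
          1 * (g (clip m n (hop i (clip m n ζ))) - g (clip m n ζ)) -
            ((if i = -m then leftDefect m n g ζ else 0) +
              if i = n then rightDefect m n g ζ else 0) := by
        intro i hi
        simp only [Finset.mem_erase, Finset.mem_Icc] at hi
        rw [rate_of_lt hi.1 (by omega) (by omega)]
        rcases hi.2.1.eq_or_lt with e | e
        · subst e
          rw [if_pos rfl, if_neg (by omega), clip_hop_left hm hn, leftDefect]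
          split_ifs <;> ring
        · rw [if_neg (by omega)]
          rcases hi.2.2.eq_or_lt with e' | e'
          · subst e'
            rw [if_pos rfl, clip_hop_right hm hn, rightDefect]
            split_ifs <;> ring
          · rw [if_neg (by omega), clip_hop_clip e e']
            ring
      rw [leftDefect_clip hm hn, rightDefect_clip hm hn, ← hg (clip m n ζ) (clip_clip m n ζ),
        ← Finset.add_sum_erase _ _ h0, Finset.sum_congr rfl hterm, Finset.sum_sub_distrib,
        Finset.sum_add_distrib, Finset.sum_ite_eq', Finset.sum_ite_eq', if_pos hl, if_pos hr]
      congr 1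
      rw [clip_hop_clip (by omega) (by omega)]
      simp [rate]
  rw [hsplit] at h
  simp only [expect_add, expect_sub, expect_const_mul] at h ⊢
  linarith

/-- Expectations of a function of the configuration in a window agree up to the order in `r` at
which the influence of the boundaries of the smaller system reaches the support of the function. -/
theorem expect_sub_expect_isBigO {L₁ L₂ : ℕ} (hL₁ : 1 ≤ L₁) (hL : L₁ ≤ L₂) {a₁ a₂ : ℝ}
    (ha₁ : 0 < a₁) (ha₂ : 0 < a₂) {p₁ : ℝ → Config L₁ → ℝ} {p₂ : ℝ → Config L₂ → ℝ}
    (hp₁ : ∀ r, 0 < r → IsStationary L₁ a₁ a₁ r (p₁ r))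
    (hp₂ : ∀ r, 0 < r → IsStationary L₂ a₂ a₂ r (p₂ r))
    (k : ℕ) (m n : ℤ) (hm : 1 ≤ m) (hn : 1 ≤ n) (hmL : m ≤ L₁) (hnL : n ≤ L₁)
    (f : (ℤ → Bool) → ℝ)
    (hf : ∀ ζ, f ζ ≠ 0 → (k : ℤ) + m ≤ L₁ + (max 1 (leftHoles L₂ ζ) : ℕ) ∧
      (k : ℤ) + n ≤ L₁ + (max 1 (rightParticles L₂ ζ) : ℕ)) :
    (fun r => (expect L₂ (p₂ r) fun ζ => f (clip m n ζ)) -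
      expect L₁ (p₁ r) fun ζ => f (clip m n ζ)) =O[𝓝[>] (0 : ℝ)] fun r => r ^ k := by
  induction k generalizing m n f with
  | zero =>
    simpa using (expect_isBigO_one hp₂ fun ζ => f (clip m n ζ)).sub
      (expect_isBigO_one hp₁ fun ζ => f (clip m n ζ))
  | succ k ihk =>
    -- At fixed order, defects enlarge the window; the inner induction is on its distance to the
    -- boundaries of the smaller system.
    induction hd : ((L₁ - m) + (L₁ - n)).toNat using Nat.strong_induction_on
      generalizing m n f with
    | _ d ihd =>
    -- If `f` is nonzero at the step, where both counts are zero, the support condition holds for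
    -- every `ζ`. Subtracting a constant is then harmless, and it cancels in the difference of
    -- expectations.
    wlog hfs : f stepConfig = 0 generalizing f
    · have hall : ∀ ζ, ((k + 1 : ℕ) : ℤ) + m ≤ L₁ + (max 1 (leftHoles L₂ ζ) : ℕ) ∧
          ((k + 1 : ℕ) : ℤ) + n ≤ L₁ + (max 1 (rightParticles L₂ ζ) : ℕ) := by
        intro ζ
        have := hf _ hfs
        rw [leftHoles_stepConfig, rightParticles_stepConfig] at this
        omega
      refine (this (fun ζ => f ζ - f stepConfig) (fun ζ _ => hall ζ) (sub_self _)).congr' ?_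
        EventuallyEq.rfl
      filter_upwards [self_mem_nhdsWithin] with r hr
      rw [expect_sub, expect_sub, expect_const (hp₁ r hr).1, expect_const (hp₂ r hr).1]
      ring
    by_cases hwin : m < L₁ ∧ n < L₁
    · obtain ⟨hmL', hnL'⟩ := hwin
      obtain ⟨g, hg, hgA⟩ := exists_window_solution hm hn (fun _ => 1) (fun _ _ => one_pos) f hfs
      have hbad : ∀ ζ, g ζ ≠ 0 →
          ((k + 1 : ℕ) : ℤ) + m ≤ L₁ + (max 1 (leftHoles L₂ ζ) : ℕ) ∧
          ((k + 1 : ℕ) : ℤ) + n ≤ L₁ + (max 1 (rightParticles L₂ ζ) : ℕ) := by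
        intro ζ hζ
        by_contra hcon
        -- The set where the bound fails is closed under clipped hops off the blockage, since they
        -- do not increase either count.
        refine hζ (hgA {ζ | ¬(((k + 1 : ℕ) : ℤ) + m ≤ L₁ + (max 1 (leftHoles L₂ ζ) : ℕ) ∧
          ((k + 1 : ℕ) : ℤ) + n ≤ L₁ + (max 1 (rightParticles L₂ ζ) : ℕ))}
          (fun i hi ζ h h' => h ?_) (fun ζ h => ?_) ζ hcon)
        · simp only [Finset.mem_erase, Finset.mem_Icc] at hi
          have h1 := (leftHoles_clip_le L₂ m n _).trans
            (leftHoles_hop_le (M := L₂) (by omega) (by omega) hi.1 ζ)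
          have h2 := (rightParticles_clip_le L₂ m n _).trans
            (rightParticles_hop_le (M := L₂) (by omega) (by omega) hi.1 ζ)
          omega
        · by_contra hne
          exact h (hf ζ hne)
      have hhop : ∀ i, -m ≤ i → i ≤ n → i ≠ 0 → ∀ ζ, clip m n ζ = ζ →
          g (clip m n (hop i ζ)) - g ζ ≠ 0 →
          ((k + 1 : ℕ) : ℤ) + m ≤ L₁ + (max 1 (leftHoles L₂ ζ) : ℕ) ∧
          ((k + 1 : ℕ) : ℤ) + n ≤ L₁ + (max 1 (rightParticles L₂ ζ) : ℕ) := by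
        intro i hi1 hi2 hi0 ζ hζ hne
        by_cases h : g ζ = 0
        · have h' := hbad (clip m n (hop i ζ)) fun h' => hne (by rw [h, h', sub_zero])
          have h1 := (leftHoles_clip_le L₂ m n _).trans
            (leftHoles_hop_le (M := L₂) (by omega) (by omega) hi0 ζ)
          have h2 := (rightParticles_clip_le L₂ m n _).trans
            (rightParticles_hop_le (M := L₂) (by omega) (by omega) hi0 ζ)
          omega
        · exact hbad ζ h
      -- The blockage jump may cost one hole and one particle, which the drop from `k + 1` to `k`
      -- absorbs.
      have hblock := ihk m n hm hn hmL hnL (fun ζ => g (clip m n (hop 0 ζ)) - g ζ) fun ζ hζ => by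
        by_cases h : g ζ = 0
        · have h' := hbad (clip m n (hop 0 ζ)) fun h' => hζ (by simp only [h, h', sub_zero])
          have h1 := (leftHoles_clip_le L₂ m n _).trans
            (leftHoles_hop_zero_le (M := L₂) (by omega) ζ)
          have h2 := (rightParticles_clip_le L₂ m n _).trans
            (rightParticles_hop_zero_le (M := L₂) (by omega) ζ)
          omega
        · have := hbad ζ h
          omega
      -- The hole at `-m + 1` makes the old count at least `1`, so the further hole at `-m` raises
      -- `max 1` of the count strictly, paying for `m + 1`.
      have hleft := ihd _ (by omega) (m + 1) n (by omega) hn (by omega) hnL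
        (fun ζ => leftDefect m n g (clip (m + 1) n ζ)) (fun ζ hζ => by
          rw [leftDefect_clip hm hn] at hζ
          obtain ⟨h1, h2, h3⟩ := leftDefect_ne_zero hm hζ
          have h4 := hhop (-m) le_rfl (by omega) (by omega) _ (clip_clip m n ζ) h3
          have h5 := leftHoles_clip_lt (M := L₂) (n := n) (by omega) (by omega) (by omega) h1
          have h6 := leftHoles_clip_lt (M := L₂) (n := n) (by omega) (by omega) (by omega) h2
          rw [sub_add_cancel] at h6
          have h7 := leftHoles_clip_le L₂ (m + 1) n ζ
          have h8 := rightParticles_clip_le L₂ m n ζ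
          omega) rfl
      have hright := ihd _ (by omega) m (n + 1) hm (by omega) hmL (by omega)
        (fun ζ => rightDefect m n g (clip m (n + 1) ζ)) (fun ζ hζ => by
          rw [rightDefect_clip hm hn] at hζ
          obtain ⟨h1, h2, h3⟩ := rightDefect_ne_zero hn hζ
          have h4 := hhop n (by omega) le_rfl (by omega) _ (clip_clip m n ζ) h3
          have h5 := rightParticles_clip_lt (M := L₂) (m := m) (by omega) (by omega) (by omega) h1
          have h6 := rightParticles_clip_lt (M := L₂) (m := m) (by omega) (by omega) (by omega) h2
          rw [sub_add_cancel] at h6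
          have h7 := rightParticles_clip_le L₂ m (n + 1) ζ
          have h8 := leftHoles_clip_le L₂ m n ζ
          omega) rfl
      simp only [clip_clip] at hleft hright
      refine ((isBigO_mul_pow hblock).neg_left.add (hleft.add hright)).congr' ?_
        EventuallyEq.rfl
      filter_upwards [self_mem_nhdsWithin] with r hr
      rw [(hp₁ r hr).expect_clip_eq hL₁ hm hn hmL' hnL' f g hg,
        (hp₂ r hr).expect_clip_eq (hL₁.trans hL) hm hn (by omega) (by omega) f g hg]
      ring
    -- With `m = L₁` or `n = L₁` the invariant alone forces order `k + 1`, so no comparison is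
    -- needed.
    · have hor : (∀ ζ, f ζ ≠ 0 → k + 1 ≤ max 1 (leftHoles L₂ ζ)) ∨
          ∀ ζ, f ζ ≠ 0 → k + 1 ≤ max 1 (rightParticles L₂ ζ) := by
        rcases hmL.eq_or_lt with e | e
        · left
          intro ζ hζ
          have := hf ζ hζ
          omega
        · right
          intro ζ hζ
          have := hf ζ hζ
          omega
      exact (expect_clip_isBigO (hL₁.trans hL) ha₂ hp₂ le_rfl (k + 1) m n f hfs hor).sub
        (expect_clip_isBigO hL₁ ha₁ hp₁ (by exact_mod_cast hL) (k + 1) m n f hfs hor)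

/-! ### The current -/

open Classical in
theorem blockageCurrent_eq {L : ℕ} (hL : 1 ≤ L) (r : ℝ) (p : Config L → ℝ) :
    blockageCurrent L r p =
      r * expect L p fun ζ => if clip 1 1 ζ 0 = true ∧ clip 1 1 ζ 1 = false then 1 else 0 := by
  have h0 : (0 : ℤ) ∈ Finset.Icc (1 - (L : ℤ)) (L : ℤ) := Finset.mem_Icc.2 (by omega)
  have h1 : (1 : ℤ) ∈ Finset.Icc (1 - (L : ℤ)) (L : ℤ) := Finset.mem_Icc.2 (by omega)
  have hsum : blockageCurrent L r p = ∑ i : Site L, if (i : ℤ) = 0 then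
      (∑ j : Site L, if (j : ℤ) = 1 then
        r * ∑ η : Config L with η i = true ∧ η j = false, p η else 0) else 0 := by
    refine Finset.sum_congr rfl fun i _ => ?_
    split_ifs with h
    · simp only [h, true_and]
    · simp only [h, false_and, if_false, Finset.sum_const_zero]
  rw [hsum, sum_site_ite L h0, sum_site_ite L h1, Finset.sum_filter, expect]
  congr 1
  refine Finset.sum_congr rfl fun η _ => ?_
  have e0 : clip 1 1 (extend L η) 0 = η ⟨0, h0⟩ := by simp [clip, extend, h0]
  have e1 : clip 1 1 (extend L η) 1 = η ⟨1, h1⟩ := by simp [clip, extend, h1]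
  simp only [e0, e1, mul_ite, mul_one, mul_zero]

theorem exists_isStationary_J_eq {L : ℕ} (hL : 1 ≤ L) {a : ℝ} (ha : 0 < a) :
    ∃ p : ℝ → Config L → ℝ, ∀ r, 0 < r →
      IsStationary L a a r (p r) ∧ J L r a = blockageCurrent L r (p r) := by
  have h : ∀ r, ∃ p : Config L → ℝ, 0 < r →
      IsStationary L a a r p ∧ J L r a = blockageCurrent L r p := by
    intro r
    by_cases hr : 0 < r
    · have hex := (existsUnique_isStationary hL ha hr).exists
      exact ⟨hex.choose, fun _ => ⟨hex.choose_spec, dif_pos hex⟩⟩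
    · exact ⟨0, fun h => absurd h hr⟩
  choose p hp using h
  exact ⟨p, hp⟩

end BlockedTASEP

/-- The first part says that the stationary states, in terms of which the currents are defined,
exist and are unique; the second part is the comparison of the currents as `r` tends to `0`. -/
theorem theorem2 (L₁ L₂ : ℕ) (hL₁ : 1 ≤ L₁) (hL : L₁ ≤ L₂) (a : ℝ) (ha : 0 < a) :
    (∀ r : ℝ, 0 < r →
      (∃! p : BlockedTASEP.Config L₁ → ℝ, BlockedTASEP.IsStationary L₁ 1 1 r p) ∧
      (∃! p : BlockedTASEP.Config L₂ → ℝ, BlockedTASEP.IsStationary L₂ a a r p)) ∧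
    (fun r : ℝ => BlockedTASEP.J L₂ r a - BlockedTASEP.J L₁ r 1)
      =O[𝓝[>] (0 : ℝ)] (fun r : ℝ => r ^ (L₁ + 1)) := by
  have hL₂ := hL₁.trans hL
  refine ⟨fun r hr => ⟨BlockedTASEP.existsUnique_isStationary hL₁ one_pos hr,
    BlockedTASEP.existsUnique_isStationary hL₂ ha hr⟩, ?_⟩
  classical
  obtain ⟨p₁, hp₁⟩ := BlockedTASEP.exists_isStationary_J_eq hL₁ one_pos
  obtain ⟨p₂, hp₂⟩ := BlockedTASEP.exists_isStationary_J_eq hL₂ ha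
  have h := BlockedTASEP.expect_sub_expect_isBigO hL₁ hL one_pos ha (fun r hr => (hp₁ r hr).1)
    (fun r hr => (hp₂ r hr).1) L₁ 1 1 le_rfl le_rfl (by exact_mod_cast hL₁)
    (by exact_mod_cast hL₁) (fun ζ => if ζ 0 = true ∧ ζ 1 = false then 1 else 0)
    (fun ζ _ => by omega)
  refine (BlockedTASEP.isBigO_mul_pow h).congr' ?_ EventuallyEq.rfl
  filter_upwards [self_mem_nhdsWithin] with r hr
  rw [(hp₁ r hr).2, (hp₂ r hr).2, BlockedTASEP.blockageCurrent_eq hL₁,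
    BlockedTASEP.blockageCurrent_eq hL₂, mul_sub]
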